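/- Let $k\ge 1$ and $\mu\in\mathbb R$. For each sub-sample length $m$, a pooled sample consists of $k$ sub-samples $(X_{i,1},\dots,X_{i,m})$, $1\le i\le k$; the $i$-th one is i.i.d. with mean $\mu$ and finite variance $\sigma_i^2$, its population law not depending on $m$. (No assumption is needed on the dependence between different sub-samples.) A scenario $P_\theta$ consists of such population laws together with a joint law of the pooled sample for each $m$. Let $\{P_\theta\}_{\theta\in\Theta}$ be a family of scenarios with common $k,\mu$ in which every vector $(\sigma_1^2,\dots,\sigma_k^2)$ of positive variances occurs. Write $\sigma_i^2(\theta)$ for the variances under $P_\theta$. For $0<\underline\sigma^2\le\overline\sigma^2$ let $$\hat{\mathbb E}_{\underline\sigma^2,\overline\sigma^2}[T]=\sup\{\mathbb E_\theta[T]:\ \sigma_i^2(\theta)\in[\underline\sigma^2,\overline\sigma^2]\ \text{for all } i\}$$ be the sublinear expectation under variance uncertainty. A statistic is a sequence $T=(T_m)$ of functions of the pooled sample such that $T_m$ is integrable under every scenario for all $m\ge2$. It is called asymptotically unbiased for the upper variance if $\lim_{m\to\infty}\hat{\mathbb E}_{\underline\sigma^2,\overline\sigma^2}[T_m]=\overline\sigma^2$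 for all $0<\underline\sigma^2\le\overline\sigma^2$, and for the lower variance if $\lim_{m\to\infty}-\hat{\mathbb E}_{\underline\sigma^2,\overline\sigma^2}[-T_m]=\underline\sigma^2$ for all $0<\underline\sigma^2\le\overline\sigma^2$. Let $$\bar X_i=\frac1m\sum_{j=1}^m X_{i,j},\qquad S_{mi}^2=\frac1{m-1}\sum_{j=1}^m (X_{i,j}-\bar X_i)^2,\qquad \hat{\overline\sigma}{}^2_m=\max_{1\le i\le k}S_{mi}^2,\qquad \hat{\underline\sigma}{}^2_m=\min_{1\le i\le k}S_{mi}^2 .$$ Then the following hold. 1. Under every scenario, $\mathbb E_\theta[\hat{\overline\sigma}{}^2_m]\to\max_i\sigma_i^2(\theta)$ and $\mathbb E_\theta[\hat{\underline\sigma}{}^2_m]\to\min_i\sigma_i^2(\theta)$ as $m\to\infty$. 2. Suppose that for all $0<\underline\sigma^2\le\overline\sigma^2$ the expectations $\mathbb E_\theta[((X_{i,1}-\mu)^2-c)^+]$ tend to $0$ as $c\to\infty$, uniformly over $i$ and over the scenarios with all variances in $[\underline\sigma^2,\overline\sigma^2]$ (as is the case when $X_{i,j}=\mu+\sigma_i\varepsilon_{i,j}$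 with standardized noise $\varepsilon_{i,j}$ whose law does not depend on the scenario). Then $\hat{\overline\sigma}{}^2$ is asymptotically unbiased for the upper variance and $\hat{\underline\sigma}{}^2$ is asymptotically unbiased for the lower variance. 3. $\hat{\overline\sigma}{}^2$ is asymptotically the largest: if $T$ is asymptotically unbiased for the upper variance, then $\limsup_{m\to\infty}\hat{\mathbb E}_{\underline\sigma^2,\overline\sigma^2}[T_m-\hat{\overline\sigma}{}^2_m]\le 0$ for all $0<\underline\sigma^2\le\overline\sigma^2$. If moreover $T_m=f(S_{m1}^2,\dots,S_{mk}^2)$ with a fixed Lipschitz function $f:\mathbb R^k\to\mathbb R$, then $T_m\le\hat{\overline\sigma}{}^2_m$ for every $m\ge2$ and every pooled sample. 4. $\hat{\underline\sigma}{}^2$ is asymptotically the smallest: if $T$ is asymptotically unbiased for the lower variance, then $\limsup_{m\to\infty}\hat{\mathbb E}_{\underline\sigma^2,\overline\sigma^2}[\hat{\underline\sigma}{}^2_m-T_m]\le 0$ for all $0<\underline\sigma^2\le\overline\sigma^2$. If moreover $T_m=f(S_{m1}^2,\dots,S_{mk}^2)$ with a fixed Lipschitz function $f:\mathbb R^k\to\mathbb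 R$, then $T_m\ge\hat{\underline\sigma}{}^2_m$ for every $m\ge2$ and every pooled sample. -/

import Mathlib

open MeasureTheory ProbabilityTheory Filter Topology

noncomputable section

/-- A data-generating scenario for `k` sub-samples with common mean `μ`. The observations of the
`i`-th sub-sample have law `pop i`, of mean `μ` and finite variance. `law m` is the joint law of the
pooled sample made of `k` sub-samples of length `m`; `x i j` is the `j`-th observation of the `i`-th
sub-sample. Each sub-sample is i.i.d.: its law is the `m`-fold product of `pop i`. Nothing is
required of the dependence between different sub-samples (they may be independent). -/
structure Scenario (k : ℕ) (μ : ℝ) where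
  pop : Fin k → Measure ℝ
  law : (m : ℕ) → Measure (Fin k → Fin m → ℝ)
  pop_prob : ∀ i, IsProbabilityMeasure (pop i)
  law_prob : ∀ m, IsProbabilityMeasure (law m)
  iid : ∀ m i, (law m).map (fun x => x i) = Measure.pi (fun _ : Fin m => pop i)
  memLp_two : ∀ i, MemLp (fun t : ℝ => t) 2 (pop i)
  mean_eq : ∀ i, ∫ t, t ∂(pop i) = μ

/-- The variance `σᵢ²` of the `i`-th sub-sample. -/
def Scenario.var {k : ℕ} {μ : ℝ} (P : Scenario k μ) (i : Fin k) : ℝ :=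
  ∫ t, (t - μ) ^ 2 ∂(P.pop i)

/-- The mean of a sample of size `m`. -/
def sampleMean {m : ℕ} (x : Fin m → ℝ) : ℝ := (∑ j, x j) / (m : ℝ)

/-- The sample variance (with denominator `m - 1`) of a sample of size `m`. -/
def sampleVar {m : ℕ} (x : Fin m → ℝ) : ℝ :=
  (∑ j, (x j - sampleMean x) ^ 2) / ((m : ℝ) - 1)

/-- The largest entry of a vector. -/
def vecMax {k : ℕ} [NeZero k] (z : Fin k → ℝ) : ℝ :=
  Finset.univ.sup' Finset.univ_nonempty z

/-- The smallest entry of a vector. -/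
def vecMin {k : ℕ} [NeZero k] (z : Fin k → ℝ) : ℝ :=
  Finset.univ.inf' Finset.univ_nonempty z

/-- The vector of the `k` sub-sample variances. -/
def subVars {k m : ℕ} (x : Fin k → Fin m → ℝ) : Fin k → ℝ := fun i => sampleVar (x i)

/-- A statistic of the pooled sample, for every sub-sample length `m`. -/
abbrev Statistic (k : ℕ) : Type := (m : ℕ) → (Fin k → Fin m → ℝ) → ℝ

/-- The maximum of the sub-sample variances. -/
def maxVar (k : ℕ) [NeZero k] : Statistic k := fun _ x => vecMax (subVars x)

/-- The minimum of the sub-sample variances. -/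
def minVar (k : ℕ) [NeZero k] : Statistic k := fun _ x => vecMin (subVars x)

section Model

variable {k : ℕ} {μ : ℝ} {Θ : Type*}

/-- The scenarios of the model whose variances all lie in `[a, b]`. -/
def scenariosIn (M : Θ → Scenario k μ) (a b : ℝ) : Set Θ :=
  {θ | ∀ i, (M θ).var i ∈ Set.Icc a b}

/-- The sublinear expectation under variance uncertainty `[a, b]`: the supremum of the linear
expectations of `T m` over all scenarios with variances in `[a, b]`. -/
def upperMean (M : Θ → Scenario k μ) (a b : ℝ) (T : Statistic k) (m : ℕ) : EReal :=
  ⨆ θ ∈ scenariosIn M a b, ((∫ x, T m x ∂((M θ).law m) : ℝ) : EReal)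

/-- The conjugate lower expectation `-Ê[-T]`. -/
def lowerMean (M : Θ → Scenario k μ) (a b : ℝ) (T : Statistic k) (m : ℕ) : EReal :=
  - upperMean M a b (fun m x => - T m x) m

/-- `T` has a finite linear expectation under every scenario. -/
def IntegrableStatistic (M : Θ → Scenario k μ) (T : Statistic k) : Prop :=
  ∀ θ, ∀ m, 2 ≤ m → Integrable (T m) ((M θ).law m)

/-- `T` is asymptotically unbiased for the upper variance: whatever the unknown bounds
`0 < a ≤ b` of the variances are, its sublinear expectation tends to `b`. -/
def AsympUnbiasedUpper (M : Θ → Scenario k μ) (T : Statistic k) : Prop :=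
  IntegrableStatistic M T ∧
    ∀ a b : ℝ, 0 < a → a ≤ b → Tendsto (upperMean M a b T) atTop (𝓝 (b : EReal))

/-- `T` is asymptotically unbiased for the lower variance: whatever the unknown bounds
`0 < a ≤ b` of the variances are, its lower expectation tends to `a`. -/
def AsympUnbiasedLower (M : Θ → Scenario k μ) (T : Statistic k) : Prop :=
  IntegrableStatistic M T ∧
    ∀ a b : ℝ, 0 < a → a ≤ b → Tendsto (lowerMean M a b T) atTop (𝓝 (a : EReal))

/-- `T ≤ T'` asymptotically: under all variance bounds, the sublinear expectation of `T - T'` is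
asymptotically at most `0` (the mean of `T` exceeds that of `T'` by at most `o(1)`,
uniformly over the scenarios). -/
def AsympLE (M : Θ → Scenario k μ) (T T' : Statistic k) : Prop :=
  ∀ a b : ℝ, 0 < a → a ≤ b →
    limsup (upperMean M a b (fun m x => T m x - T' m x)) atTop ≤ 0

/-- The variances are unknown: every vector of positive variances occurs in the model. -/
def AllVariancesPossible (M : Θ → Scenario k μ) : Prop :=
  ∀ v : Fin k → ℝ, (∀ i, 0 < v i) → ∃ θ, ∀ i, (M θ).var i = v i

/-- Integrability of the squared deviations under the sublinear expectation:
`Ê[((X - μ)² - c)⁺] → 0` as `c → ∞`. It holds when the scenarios are `X = μ + σᵢ ε` with a fixed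
noise `ε` and bounded `σᵢ`, and when `Ê[(X - μ)⁴] < ∞`. -/
def UniformlySquareIntegrable (M : Θ → Scenario k μ) : Prop :=
  ∀ a b : ℝ, 0 < a → a ≤ b → ∀ ε : ℝ, 0 < ε → ∃ c : ℝ, ∀ θ ∈ scenariosIn M a b, ∀ i,
    ∫ t, max ((t - μ) ^ 2 - c) 0 ∂((M θ).pop i) ≤ ε

end Model

end

/-! Each sample variance `S_i²` is unbiased and converges in `L¹` to `σ_i²`, with an explicit rate
obtained by truncating the squared deviations. Hence the mean of a Lipschitz function `f` of the
sub-sample variances tends to `f(σ²)`, at a rate uniform in the scenario when the tails are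
uniformly small. Applied to the maximum and the minimum, this gives the limits under each scenario
and asymptotic unbiasedness.

Extremality rests on two facts. Since unbiasedness is required for all bounds, a scenario with
largest variance `s` may be tested with an upper bound at or just above `s`; so the mean of `T` is
at most `s + o(1)`, and a finite grid of bounds makes this uniform. On the other side, `E max S_i² ≥
max E S_i² = s` exactly, for every `m ≥ 2`. Neither fact needs uniform integrability. For `T =
f(S²)` the means converge to `f(v)`, so `f(v) ≤ max v` for every positive `v`, and continuity
extends this to all values of the sample variances. The lower variance is symmetric. -/

/-! ### Moments and `L¹` rates for one i.i.d. sample -/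

section Sampling

variable {ν : Measure ℝ} [IsProbabilityMeasure ν] {m : ℕ} {h : ℝ → ℝ}

theorem integrable_empiricalMean (hh : Integrable h ν) :
    Integrable (fun x : Fin m → ℝ => (∑ j, h (x j)) / (m : ℝ)) (Measure.pi fun _ => ν) :=
  (integrable_finsetSum _ fun _ _ => integrable_comp_eval hh).div_const _

theorem integral_empiricalMean (hm : m ≠ 0) (hh : Integrable h ν) :
    ∫ x : Fin m → ℝ, (∑ j, h (x j)) / (m : ℝ) ∂(Measure.pi fun _ => ν) = ∫ t, h t ∂ν := by
  have hm' : (m : ℝ) ≠ 0 := by exact_mod_cast hm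
  have (j : Fin m) : ∫ x : Fin m → ℝ, h (x j) ∂(Measure.pi fun _ => ν) = ∫ t, h t ∂ν :=
    integral_comp_eval (μ := fun _ => ν) hh.aestronglyMeasurable
  rw [integral_div, integral_finsetSum _ fun _ _ => integrable_comp_eval hh]
  simp [this, hm']

theorem memLp_empiricalMean (hh : MemLp h 2 ν) :
    MemLp (fun x : Fin m → ℝ => (∑ j, h (x j)) / (m : ℝ)) 2 (Measure.pi fun _ => ν) := by
  simp_rw [div_eq_mul_inv]
  exact (memLp_finsetSum _ fun j _ =>
    hh.comp_measurePreserving (measurePreserving_eval (fun _ : Fin m => ν) j)).mul_const _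

theorem integrable_sq_empiricalMean_sub (hh : MemLp h 2 ν) (c : ℝ) :
    Integrable (fun x : Fin m → ℝ => ((∑ j, h (x j)) / (m : ℝ) - c) ^ 2)
      (Measure.pi fun _ => ν) :=
  ((memLp_empiricalMean hh).sub (memLp_const c)).integrable_sq

theorem integral_sq_empiricalMean_sub (hm : m ≠ 0) (hh : MemLp h 2 ν) :
    ∫ x : Fin m → ℝ, ((∑ j, h (x j)) / (m : ℝ) - ∫ t, h t ∂ν) ^ 2 ∂(Measure.pi fun _ => ν)
      = Var[h; ν] / m := by
  have hm' : (m : ℝ) ≠ 0 := by exact_mod_cast hm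
  have hint : Integrable h ν := hh.integrable (by norm_num)
  have hvar := variance_sum_pi (μ := fun _ : Fin m => ν) (X := fun _ => h) fun _ => hh
  rw [← integral_empiricalMean hm hint,
    ← variance_eq_integral (memLp_empiricalMean hh).aemeasurable]
  have : (fun x : Fin m → ℝ => (∑ j, h (x j)) / (m : ℝ))
      = fun x => (m : ℝ)⁻¹ * (∑ j, fun x : Fin m → ℝ => h (x j)) x := by
    funext x
    simp [div_eq_inv_mul]
  rw [this, variance_const_mul, hvar]
  simp only [Finset.sum_const, Finset.card_univ, Fintype.card_fin, nsmul_eq_mul]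
  field_simp

/-- The weak law of large numbers in `L¹` for bounded observations, with a rate. -/
theorem integral_abs_empiricalMean_sub_le (hm : m ≠ 0) (hmeas : Measurable h) {c : ℝ}
    (h0 : ∀ t, 0 ≤ h t) (hc : ∀ t, h t ≤ c) :
    ∫ x : Fin m → ℝ, |(∑ j, h (x j)) / (m : ℝ) - ∫ t, h t ∂ν| ∂(Measure.pi fun _ => ν)
      ≤ c / √m := by
  have hm' : (0 : ℝ) < m := by exact_mod_cast Nat.pos_of_ne_zero hm
  have hc0 : 0 ≤ c := (h0 0).trans (hc 0)
  have hh : MemLp h 2 ν := MemLp.of_bound hmeas.aestronglyMeasurable c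
    (ae_of_all _ fun t => by rw [Real.norm_of_nonneg (h0 t)]; exact hc t)
  have hZ : MemLp (fun x : Fin m → ℝ => |(∑ j, h (x j)) / (m : ℝ) - ∫ t, h t ∂ν|) 2
      (Measure.pi fun _ => ν) := ((memLp_empiricalMean hh).sub (memLp_const _)).abs
  have hvar : Var[h; ν] ≤ c ^ 2 := by
    refine (variance_le_sq_of_bounded (a := 0) (b := c) (ae_of_all _ fun t => ⟨h0 t, hc t⟩)
      hmeas.aemeasurable).trans ?_
    nlinarith [sq_nonneg c]
  -- Nonnegativity of the variance of `|Z|` is the inequality `(E|Z|)² ≤ E Z²`.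
  have hnn := variance_nonneg (fun x : Fin m → ℝ => |(∑ j, h (x j)) / (m : ℝ) - ∫ t, h t ∂ν|)
    (Measure.pi fun _ => ν)
  rw [variance_eq_sub hZ] at hnn
  simp only [Pi.pow_apply, sq_abs] at hnn
  rw [integral_sq_empiricalMean_sub hm hh] at hnn
  refine (le_div_iff₀ (Real.sqrt_pos.2 hm')).2 (le_of_sq_le_sq ?_ hc0)
  rw [mul_pow, Real.sq_sqrt hm'.le]
  calc _ ≤ Var[h; ν] / m * m := by gcongr; linarith
    _ = Var[h; ν] := by field_simp
    _ ≤ c ^ 2 := hvar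

/-- Moving the centre from the sample mean to a fixed `μ` leaves two empirical means, whose moments
are known; the factors `m` are kept to expose them. -/
theorem sub_one_mul_sampleVar (hm : 2 ≤ m) (μ : ℝ) (x : Fin m → ℝ) :
    ((m : ℝ) - 1) * sampleVar x
      = m * ((∑ j, (x j - μ) ^ 2) / (m : ℝ)) - m * ((∑ j, x j) / (m : ℝ) - μ) ^ 2 := by
  have hm' : (2 : ℝ) ≤ m := by exact_mod_cast hm
  have h1 : (m : ℝ) - 1 ≠ 0 := by linarith
  have h0 : (m : ℝ) ≠ 0 := by linarith
  have hs : ∑ j, x j = m * sampleMean x := by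
    unfold sampleMean; field_simp
  have hexp : ∑ j, (x j - μ) ^ 2
      = ∑ j, (x j - sampleMean x) ^ 2 + m * (sampleMean x - μ) ^ 2 := by
    have : ∀ j, (x j - μ) ^ 2 = (x j - sampleMean x) ^ 2
        + (2 * (sampleMean x - μ) * x j + (μ ^ 2 - sampleMean x ^ 2)) := fun j => by ring
    simp only [this, Finset.sum_add_distrib, ← Finset.mul_sum, hs, Finset.sum_const,
      Finset.card_univ, Fintype.card_fin, nsmul_eq_mul]
    ring
  rw [hexp, hs]
  unfold sampleVar
  field_simp
  ring

theorem sampleVar_nonneg (hm : 2 ≤ m) (x : Fin m → ℝ) : 0 ≤ sampleVar x := by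
  have hm' : (2 : ℝ) ≤ m := by exact_mod_cast hm
  exact div_nonneg (Finset.sum_nonneg fun _ _ => sq_nonneg _) (by linarith)

variable {μ : ℝ}

theorem sampleVar_eq (hm : 2 ≤ m) (μ : ℝ) (x : Fin m → ℝ) : sampleVar x
    = ((m : ℝ) - 1)⁻¹ * (m * ((∑ j, (x j - μ) ^ 2) / (m : ℝ))
        - m * ((∑ j, x j) / (m : ℝ) - μ) ^ 2) := by
  have hm' : (2 : ℝ) ≤ m := by exact_mod_cast hm
  have h1 : (m : ℝ) - 1 ≠ 0 := by linarith
  rw [← sub_one_mul_sampleVar hm, inv_mul_cancel_left₀ h1]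

theorem integrable_sq_sub (hν : MemLp (fun t : ℝ => t) 2 ν) (μ : ℝ) :
    Integrable (fun t => (t - μ) ^ 2) ν :=
  (hν.sub (memLp_const μ)).integrable_sq

theorem integrable_sampleVar (hm : 2 ≤ m) (hν : MemLp (fun t : ℝ => t) 2 ν) :
    Integrable (fun x : Fin m → ℝ => sampleVar x) (Measure.pi fun _ => ν) := by
  -- Any centre serves for integrability.
  simp_rw [sampleVar_eq hm 0]
  exact (((integrable_empiricalMean (integrable_sq_sub hν 0)).const_mul _).sub
    ((integrable_sq_empiricalMean_sub hν 0).const_mul _)).const_mul _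

theorem integral_sq_sampleMean_sub (hm : m ≠ 0) (hν : MemLp (fun t : ℝ => t) 2 ν)
    (hμ : ∫ t, t ∂ν = μ) :
    ∫ x : Fin m → ℝ, ((∑ j, x j) / (m : ℝ) - μ) ^ 2 ∂(Measure.pi fun _ => ν)
      = (∫ t, (t - μ) ^ 2 ∂ν) / m := by
  have := integral_sq_empiricalMean_sub hm hν
  rwa [variance_eq_integral hν.aemeasurable, hμ] at this

/-- The sample variance is unbiased. -/
theorem integral_sampleVar (hm : 2 ≤ m) (hν : MemLp (fun t : ℝ => t) 2 ν)
    (hμ : ∫ t, t ∂ν = μ) :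
    ∫ x : Fin m → ℝ, sampleVar x ∂(Measure.pi fun _ => ν) = ∫ t, (t - μ) ^ 2 ∂ν := by
  have hm' : (2 : ℝ) ≤ m := by exact_mod_cast hm
  have h1 : (m : ℝ) - 1 ≠ 0 := by linarith
  have h0 : (m : ℝ) ≠ 0 := by linarith
  have hY := integrable_sq_sub hν μ
  simp_rw [sampleVar_eq hm μ]
  rw [integral_const_mul, integral_sub ((integrable_empiricalMean hY).const_mul _)
    ((integrable_sq_empiricalMean_sub hν μ).const_mul _), integral_const_mul, integral_const_mul,
    integral_empiricalMean (by lia) hY, integral_sq_sampleMean_sub (by lia) hν hμ]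
  field_simp

/-- Convergence in `L¹` of the sample variance, with a rate in terms of the tail of the squared
deviation beyond a truncation level `c`. -/
theorem integral_abs_sampleVar_sub_le (hm : 2 ≤ m) (hν : MemLp (fun t : ℝ => t) 2 ν)
    (hμ : ∫ t, t ∂ν = μ) {c : ℝ} (hc : 0 ≤ c) :
    ∫ x : Fin m → ℝ, |sampleVar x - ∫ t, (t - μ) ^ 2 ∂ν| ∂(Measure.pi fun _ => ν)
      ≤ 2 * c / √m + 4 * (∫ t, max ((t - μ) ^ 2 - c) 0 ∂ν)
        + 4 * (∫ t, (t - μ) ^ 2 ∂ν) / m := by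
  have hm' : (2 : ℝ) ≤ m := by exact_mod_cast hm
  have h0 : (0 : ℝ) < m := by linarith
  have hm0 : m ≠ 0 := by lia
  have h1 : 0 < (m : ℝ) - 1 := by linarith
  have hY := integrable_sq_sub hν μ
  have hlow : Integrable (fun t => min ((t - μ) ^ 2) c) ν := hY.inf (integrable_const c)
  have hhigh : Integrable (fun t => max ((t - μ) ^ 2 - c) 0) ν :=
    (hY.sub (integrable_const c)).pos_part
  -- The part truncated at `c` is bounded and obeys the `L¹` rate; the excess is controlled only
  -- through its mean.
  have hsplit : ∀ t : ℝ, (t - μ) ^ 2 = min ((t - μ) ^ 2) c + max ((t - μ) ^ 2 - c) 0 := by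
    intro t
    rcases le_total ((t - μ) ^ 2) c with h | h
    · rw [min_eq_left h, max_eq_right (by linarith), add_zero]
    · rw [min_eq_right h, max_eq_left (by linarith)]; ring
  have hσ : ∫ t, (t - μ) ^ 2 ∂ν
      = ∫ t, min ((t - μ) ^ 2) c ∂ν + ∫ t, max ((t - μ) ^ 2 - c) 0 ∂ν := by
    rw [← integral_add hlow hhigh]
    exact integral_congr_ae (ae_of_all _ hsplit)
  have hσ0 : 0 ≤ ∫ t, (t - μ) ^ 2 ∂ν := integral_nonneg fun t => sq_nonneg _
  have hδ0 : 0 ≤ ∫ t, max ((t - μ) ^ 2 - c) 0 ∂ν := integral_nonneg fun t => le_max_right _ _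
  have hA := integral_abs_empiricalMean_sub_le (ν := ν) (c := c) hm0
    (h := fun t => min ((t - μ) ^ 2) c) (by fun_prop)
    (fun t => le_min (sq_nonneg _) hc) (fun t => min_le_right _ _)
  have hB := integral_empiricalMean (ν := ν) hm0 hhigh
  have hD := integral_sq_sampleMean_sub hm0 hν hμ
  have iA : Integrable (fun x : Fin m → ℝ => |(∑ j, min ((x j - μ) ^ 2) c) / (m : ℝ)
      - ∫ t, min ((t - μ) ^ 2) c ∂ν|) (Measure.pi fun _ => ν) :=
    ((integrable_empiricalMean (m := m) hlow).sub (integrable_const _)).abs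
  have iB := integrable_empiricalMean (m := m) hhigh
  have iD := integrable_sq_empiricalMean_sub (m := m) hν μ
  set σ := ∫ t, (t - μ) ^ 2 ∂ν
  set α := ∫ t, min ((t - μ) ^ 2) c ∂ν
  set δ := ∫ t, max ((t - μ) ^ 2 - c) 0 ∂ν
  have key : ∀ x : Fin m → ℝ, |sampleVar x - σ| ≤
      2 * (|(∑ j, min ((x j - μ) ^ 2) c) / (m : ℝ) - α|
        + (∑ j, max ((x j - μ) ^ 2 - c) 0) / (m : ℝ)
        + ((∑ j, x j) / (m : ℝ) - μ) ^ 2 + (δ + σ / m)) := by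
    intro x
    have hB0 : 0 ≤ (∑ j, max ((x j - μ) ^ 2 - c) 0) / (m : ℝ) :=
      div_nonneg (Finset.sum_nonneg fun _ _ => le_max_right _ _) h0.le
    have hsum : (∑ j, (x j - μ) ^ 2) / (m : ℝ) = (∑ j, min ((x j - μ) ^ 2) c) / (m : ℝ)
        + (∑ j, max ((x j - μ) ^ 2 - c) 0) / (m : ℝ) := by
      rw [← add_div, ← Finset.sum_add_distrib]
      exact congrArg (· / (m : ℝ)) (Finset.sum_congr rfl fun j _ => hsplit (x j))
    have hid := sub_one_mul_sampleVar hm μ x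
    rw [hsum] at hid
    set A := (∑ j, min ((x j - μ) ^ 2) c) / (m : ℝ)
    set B := (∑ j, max ((x j - μ) ^ 2 - c) 0) / (m : ℝ)
    set D := ((∑ j, x j) / (m : ℝ) - μ) ^ 2
    have hD0 : 0 ≤ D := sq_nonneg _
    -- The term `σ / m` compensates for `m - 1` against `m`.
    have hR : ((m : ℝ) - 1) * (sampleVar x - σ)
        = m * ((A - α) + (B - δ) - D + σ / m) := by
      rw [mul_sub, hid, hσ]; field_simp; ring
    have hσm : 0 ≤ σ / m := by positivity
    have habs : |(A - α) + (B - δ) - D + σ / m| ≤ |A - α| + B + D + (δ + σ / m) := by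
      have := abs_le.1 (le_refl |A - α|)
      exact abs_le.2 ⟨by linarith, by linarith⟩
    have hpos : 0 ≤ |A - α| + B + D + (δ + σ / m) := (abs_nonneg _).trans habs
    have : ((m : ℝ) - 1) * |sampleVar x - σ|
        ≤ ((m : ℝ) - 1) * (2 * (|A - α| + B + D + (δ + σ / m))) := by
      rw [← abs_of_pos h1, ← abs_mul, hR, abs_mul, abs_of_pos h0, abs_of_pos h1]
      -- The factor 2 comes from `m ≤ 2 * (m - 1)`.
      nlinarith
    exact le_of_mul_le_mul_left this h1
  have iAB : Integrable (fun x : Fin m → ℝ => |(∑ j, min ((x j - μ) ^ 2) c) / (m : ℝ) - α|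
      + (∑ j, max ((x j - μ) ^ 2 - c) 0) / (m : ℝ)) (Measure.pi fun _ => ν) := iA.add iB
  have iABD : Integrable (fun x : Fin m → ℝ => |(∑ j, min ((x j - μ) ^ 2) c) / (m : ℝ) - α|
      + (∑ j, max ((x j - μ) ^ 2 - c) 0) / (m : ℝ)
      + ((∑ j, x j) / (m : ℝ) - μ) ^ 2) (Measure.pi fun _ => ν) := iAB.add iD
  refine (integral_mono ((integrable_sampleVar hm hν).sub (integrable_const σ)).abs
    ((iABD.add (integrable_const (δ + σ / m))).const_mul 2) key).trans ?_
  rw [integral_const_mul]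
  have e : ∫ x : Fin m → ℝ, (|(∑ j, min ((x j - μ) ^ 2) c) / (m : ℝ) - α|
        + (∑ j, max ((x j - μ) ^ 2 - c) 0) / (m : ℝ)
        + ((∑ j, x j) / (m : ℝ) - μ) ^ 2 + (δ + σ / m)) ∂(Measure.pi fun _ => ν)
      = ∫ x : Fin m → ℝ, |(∑ j, min ((x j - μ) ^ 2) c) / (m : ℝ) - α| ∂(Measure.pi fun _ => ν)
        + δ + σ / m + (δ + σ / m) := by
    rw [integral_add iABD (integrable_const _), integral_add iAB iD, integral_add iA iB, hB, hD]
    simp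
  calc _ ≤ 2 * (c / √m + δ + σ / m + (δ + σ / m)) :=
        mul_le_mul_of_nonneg_left (e.le.trans (by gcongr)) zero_le_two
    _ = _ := by ring

/-- The tail of the squared deviation beyond a truncation level vanishes. -/
theorem tendsto_integral_sq_sub_tail (hν : MemLp (fun t : ℝ => t) 2 ν) (μ : ℝ) :
    Tendsto (fun c : ℝ => ∫ t, max ((t - μ) ^ 2 - c) 0 ∂ν) atTop (𝓝 0) := by
  have hY := integrable_sq_sub hν μ
  suffices Tendsto (fun c : ℝ => ∫ t, max ((t - μ) ^ 2 - c) 0 ∂ν) atTop (𝓝 (∫ _, (0 : ℝ) ∂ν)) by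
    simpa using this
  refine tendsto_integral_filter_of_dominated_convergence (fun t => (t - μ) ^ 2)
    (Eventually.of_forall fun c => by fun_prop) ?_ hY ?_
  · filter_upwards [eventually_ge_atTop 0] with c hc
    refine ae_of_all _ fun t => ?_
    rw [Real.norm_of_nonneg (le_max_right _ _)]
    exact max_le (by linarith) (sq_nonneg _)
  · refine ae_of_all _ fun t => tendsto_const_nhds.congr' ?_
    filter_upwards [eventually_ge_atTop ((t - μ) ^ 2)] with c hc
    exact (max_eq_right (by linarith)).symm

end Sampling

/-! ### Maximum and minimum of a vector -/

section Extremes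

variable {k : ℕ} [NeZero k]

theorem le_vecMax (z : Fin k → ℝ) (i : Fin k) : z i ≤ vecMax z :=
  Finset.le_sup' z (Finset.mem_univ i)

theorem vecMin_le (z : Fin k → ℝ) (i : Fin k) : vecMin z ≤ z i :=
  Finset.inf'_le z (Finset.mem_univ i)

theorem vecMax_le {z : Fin k → ℝ} {b : ℝ} (h : ∀ i, z i ≤ b) : vecMax z ≤ b :=
  Finset.sup'_le _ _ fun i _ => h i

theorem le_vecMin {z : Fin k → ℝ} {a : ℝ} (h : ∀ i, a ≤ z i) : a ≤ vecMin z :=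
  Finset.le_inf' _ _ fun i _ => h i

theorem exists_eq_vecMax (z : Fin k → ℝ) : ∃ i, vecMax z = z i := by
  obtain ⟨i, -, h⟩ := Finset.exists_mem_eq_sup' Finset.univ_nonempty z
  exact ⟨i, h⟩

theorem exists_eq_vecMin (z : Fin k → ℝ) : ∃ i, vecMin z = z i := by
  obtain ⟨i, -, h⟩ := Finset.exists_mem_eq_inf' Finset.univ_nonempty z
  exact ⟨i, h⟩

/-- This makes the maximum an instance of the general estimates for Lipschitz functions of the
sub-sample variances. -/
theorem lipschitzWith_vecMax : LipschitzWith 1 (vecMax : (Fin k → ℝ) → ℝ) := by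
  refine LipschitzWith.of_le_add fun z w => vecMax_le fun i => ?_
  have h := (le_abs_self _).trans (dist_le_pi_dist z w i)
  linarith [le_vecMax w i]

theorem lipschitzWith_vecMin : LipschitzWith 1 (vecMin : (Fin k → ℝ) → ℝ) := by
  refine LipschitzWith.of_le_add fun z w => ?_
  rw [← sub_le_iff_le_add]
  refine le_vecMin fun i => ?_
  have h := (le_abs_self _).trans (dist_le_pi_dist z w i)
  linarith [vecMin_le z i]

end Extremes

/-! ### Sub-sample variances under a single scenario -/

namespace Scenario

variable {k : ℕ} {μ : ℝ} (P : Scenario k μ) {m : ℕ}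

instance (i : Fin k) : IsProbabilityMeasure (P.pop i) := P.pop_prob i

instance (m : ℕ) : IsProbabilityMeasure (P.law m) := P.law_prob m

/-- The estimates below reduce to one sub-sample at a time through this projection, so the
dependence between sub-samples plays no role. -/
theorem measurePreserving_eval (m : ℕ) (i : Fin k) :
    MeasurePreserving (fun x : Fin k → Fin m → ℝ => x i) (P.law m)
      (Measure.pi fun _ => P.pop i) :=
  ⟨measurable_pi_apply i, P.iid m i⟩

theorem var_nonneg (i : Fin k) : 0 ≤ P.var i := integral_nonneg fun _ => sq_nonneg _

theorem integral_comp_eval {F : (Fin m → ℝ) → ℝ} {i : Fin k}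
    (hF : AEStronglyMeasurable F (Measure.pi fun _ => P.pop i)) :
    ∫ x, F (x i) ∂(P.law m) = ∫ y, F y ∂(Measure.pi fun _ => P.pop i) := by
  rw [← P.iid m i] at hF ⊢
  exact (integral_map (measurable_pi_apply i).aemeasurable hF).symm

theorem integrable_sampleVar (hm : 2 ≤ m) (i : Fin k) :
    Integrable (fun x : Fin k → Fin m → ℝ => sampleVar (x i)) (P.law m) :=
  (P.measurePreserving_eval m i).integrable_comp_of_integrable
    (_root_.integrable_sampleVar hm (P.memLp_two i))

theorem integral_sampleVar (hm : 2 ≤ m) (i : Fin k) :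
    ∫ x, sampleVar (x i) ∂(P.law m) = P.var i := by
  rw [P.integral_comp_eval (_root_.integrable_sampleVar hm (P.memLp_two i)).aestronglyMeasurable]
  exact _root_.integral_sampleVar hm (P.memLp_two i) (P.mean_eq i)

/-- The total mean absolute error of the sub-sample variances. -/
noncomputable def varError (m : ℕ) : ℝ := ∑ i, ∫ x, |sampleVar (x i) - P.var i| ∂(P.law m)

theorem varError_le (hm : 2 ≤ m) {c δ B : ℝ} (hc : 0 ≤ c)
    (hδ : ∀ i, ∫ t, max ((t - μ) ^ 2 - c) 0 ∂(P.pop i) ≤ δ) (hB : ∀ i, P.var i ≤ B) :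
    P.varError m ≤ k * (2 * c / √m + 4 * δ + 4 * B / m) := by
  have : ∀ i ∈ (Finset.univ : Finset (Fin k)),
      ∫ x, |sampleVar (x i) - P.var i| ∂(P.law m) ≤ 2 * c / √m + 4 * δ + 4 * B / m := by
    intro i _
    have hint := _root_.integrable_sampleVar hm (P.memLp_two i)
    rw [P.integral_comp_eval (F := fun y => |sampleVar y - P.var i|)
      (hint.sub (integrable_const _)).abs.aestronglyMeasurable]
    refine (integral_abs_sampleVar_sub_le hm (P.memLp_two i) (P.mean_eq i) hc).trans ?_
    have h1 := hδ i
    have h2 : ∫ t, (t - μ) ^ 2 ∂(P.pop i) ≤ B := hB i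
    gcongr
  exact (Finset.sum_le_card_nsmul _ _ _ this).trans_eq (by simp only [Finset.card_univ,
    Fintype.card_fin, nsmul_eq_mul])

/-- Working with a set of scenarios covers both a single scenario and a whole variance range. The
level `c` is fixed first, making the tail small; then `m` grows. -/
theorem eventually_varError_le {S : Set (Scenario k μ)} {B : ℝ}
    (hB : ∀ P ∈ S, ∀ i, P.var i ≤ B)
    (hS : ∀ ε : ℝ, 0 < ε → ∃ c : ℝ, ∀ P ∈ S, ∀ i,
      ∫ t, max ((t - μ) ^ 2 - c) 0 ∂(P.pop i) ≤ ε) {ε : ℝ} (hε : 0 < ε) :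
    ∀ᶠ m in atTop, ∀ P ∈ S, P.varError m ≤ ε := by
  have hk : (0 : ℝ) < k + 1 := by positivity
  obtain ⟨δ, hδ0, hδ⟩ : ∃ δ : ℝ, 0 < δ ∧ k * (4 * δ) < ε := by
    -- `k + 1` avoids a division by zero when `k = 0`.
    refine ⟨ε / (8 * (k + 1)), by positivity, ?_⟩
    rw [show (k : ℝ) * (4 * (ε / (8 * (k + 1)))) = ε * (k / (2 * (k + 1))) by field_simp; ring]
    have : (k : ℝ) / (2 * (k + 1)) < 1 := by rw [div_lt_one (by positivity)]; linarith
    nlinarith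
  obtain ⟨c, hc⟩ := hS δ hδ0
  have hlim : Tendsto (fun m : ℕ => (k : ℝ) * (2 * max c 0 / √m + 4 * δ + 4 * B / m)) atTop
      (𝓝 (k * (0 + 4 * δ + 0))) := by
    refine ((((tendsto_const_nhds (x := 2 * max c 0)).div_atTop
      (Real.tendsto_sqrt_atTop.comp tendsto_natCast_atTop_atTop)).add tendsto_const_nhds).add
      (tendsto_const_nhds.div_atTop tendsto_natCast_atTop_atTop)).const_mul _
  rw [zero_add, add_zero] at hlim
  filter_upwards [hlim.eventually_le_const hδ, eventually_ge_atTop 2] with m hm hm2 P hP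
  refine (P.varError_le hm2 (le_max_right c 0) (fun i => ?_) (hB P hP)).trans hm
  -- The given `c` may be negative; raising it to `max c 0` only shrinks the tail.
  refine le_trans (integral_mono ?_ ?_ fun t => ?_) (hc P hP i)
  · exact ((integrable_sq_sub (P.memLp_two i) μ).sub (integrable_const _)).pos_part
  · exact ((integrable_sq_sub (P.memLp_two i) μ).sub (integrable_const _)).pos_part
  · exact max_le_max (sub_le_sub_left (le_max_left _ _) _) le_rfl

theorem tendsto_varError : Tendsto P.varError atTop (𝓝 0) := by
  have h0 : ∀ m, 0 ≤ P.varError m := fun m =>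
    Finset.sum_nonneg fun _ _ => integral_nonneg fun _ => abs_nonneg _
  refine tendsto_order.2 ⟨fun a ha => Eventually.of_forall fun m => ha.trans_le (h0 m),
    fun a ha => ?_⟩
  have h := eventually_varError_le (S := {P}) (B := ∑ i, P.var i) ?_ ?_ (half_pos ha)
  · filter_upwards [h] with m hm
    exact (hm P rfl).trans_lt (half_lt_self ha)
  · rintro _ rfl i
    exact Finset.single_le_sum (fun j _ => var_nonneg _ j) (Finset.mem_univ i)
  · intro ε hε
    -- A single scenario has finitely many populations, so one level serves them all.
    have : ∀ᶠ c : ℝ in atTop, ∀ i, ∫ t, max ((t - μ) ^ 2 - c) 0 ∂(P.pop i) ≤ ε :=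
      eventually_all.2 fun i =>
        (tendsto_integral_sq_sub_tail (P.memLp_two i) μ).eventually_le_const hε
    obtain ⟨c, hc⟩ := this.exists
    refine ⟨c, ?_⟩
    rintro _ rfl
    exact hc

/-! ### Lipschitz functions of the sub-sample variances -/

variable {K : NNReal} {f : (Fin k → ℝ) → ℝ}

/-- The sup distance is at most the sum of the coordinate distances, and the sum can be integrated
term by term. -/
theorem abs_sub_le_sum (hf : LipschitzWith K f) (x : Fin k → Fin m → ℝ) :
    |f (subVars x) - f P.var| ≤ K * ∑ i, |sampleVar (x i) - P.var i| := by
  refine (hf.dist_le_mul _ _).trans ?_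
  gcongr
  refine (dist_pi_le_iff (Finset.sum_nonneg fun _ _ => abs_nonneg _)).2 fun i => ?_
  exact Finset.single_le_sum (f := fun i => |sampleVar (x i) - P.var i|)
    (fun _ _ => abs_nonneg _) (Finset.mem_univ i)

theorem integrable_sum_abs (hm : 2 ≤ m) :
    Integrable (fun x : Fin k → Fin m → ℝ => ∑ i, |sampleVar (x i) - P.var i|) (P.law m) :=
  integrable_finsetSum _ fun i _ => ((P.integrable_sampleVar hm i).sub (integrable_const _)).abs

theorem integrable_comp_subVars (hm : 2 ≤ m) (hf : LipschitzWith K f) :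
    Integrable (fun x => f (subVars x)) (P.law m) := by
  have hmeas : AEStronglyMeasurable (fun x => f (subVars x)) (P.law m) :=
    hf.continuous.comp_aestronglyMeasurable (aemeasurable_pi_iff.2 fun i =>
      (P.integrable_sampleVar hm i).aemeasurable).aestronglyMeasurable
  refine (((P.integrable_sum_abs hm).const_mul (K : ℝ)).add
    (integrable_const |f P.var|)).mono' hmeas (ae_of_all _ fun x => ?_)
  rw [Real.norm_eq_abs]
  have h1 := P.abs_sub_le_sum hf x
  have h2 := abs_add_le (f (subVars x) - f P.var) (f P.var)
  rw [sub_add_cancel] at h2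
  simp only [Pi.add_apply]
  linarith

theorem abs_integral_comp_subVars_sub_le (hm : 2 ≤ m) (hf : LipschitzWith K f) :
    |∫ x, f (subVars x) ∂(P.law m) - f P.var| ≤ K * P.varError m := by
  have hsub : ∫ x, f (subVars x) ∂(P.law m) - f P.var
      = ∫ x, (f (subVars x) - f P.var) ∂(P.law m) := by
    rw [integral_sub (P.integrable_comp_subVars hm hf) (integrable_const _)]
    simp
  have herr : P.varError m = ∫ x, ∑ i, |sampleVar (x i) - P.var i| ∂(P.law m) :=
    (integral_finsetSum _ fun i _ =>
      ((P.integrable_sampleVar hm i).sub (integrable_const _)).abs).symm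
  rw [hsub, herr, ← integral_const_mul]
  refine abs_integral_le_integral_abs.trans (integral_mono ?_ ?_ (P.abs_sub_le_sum hf))
  · exact ((P.integrable_comp_subVars hm hf).sub (integrable_const _)).abs
  · exact (P.integrable_sum_abs hm).const_mul _

theorem tendsto_integral_comp_subVars (hf : LipschitzWith K f) :
    Tendsto (fun m => ∫ x, f (subVars x) ∂(P.law m)) atTop (𝓝 (f P.var)) := by
  refine tendsto_iff_dist_tendsto_zero.2 (squeeze_zero' (Eventually.of_forall fun _ => dist_nonneg)
    ?_ (by simpa using P.tendsto_varError.const_mul (K : ℝ)))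
  filter_upwards [eventually_ge_atTop 2] with m hm
  exact P.abs_integral_comp_subVars_sub_le hm hf

variable [NeZero k]

theorem integrable_maxVar (hm : 2 ≤ m) : Integrable (maxVar k m) (P.law m) :=
  P.integrable_comp_subVars hm lipschitzWith_vecMax

theorem integrable_minVar (hm : 2 ≤ m) : Integrable (minVar k m) (P.law m) :=
  P.integrable_comp_subVars hm lipschitzWith_vecMin

/-- The maximum dominates each `S_i²`, which is exactly unbiased; hence there is no error term. -/
theorem vecMax_var_le_integral (hm : 2 ≤ m) :
    vecMax P.var ≤ ∫ x, maxVar k m x ∂(P.law m) := by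
  refine vecMax_le fun i => ?_
  rw [← P.integral_sampleVar hm i]
  exact integral_mono (P.integrable_sampleVar hm i)
    (P.integrable_maxVar hm) fun x => le_vecMax (subVars x) i

theorem integral_le_vecMin_var (hm : 2 ≤ m) :
    ∫ x, minVar k m x ∂(P.law m) ≤ vecMin P.var := by
  refine le_vecMin fun i => ?_
  rw [← P.integral_sampleVar hm i]
  exact integral_mono (P.integrable_minVar hm)
    (P.integrable_sampleVar hm i) fun x => vecMin_le (subVars x) i

end Scenario

/-! ### Limits of the sublinear expectation -/

section Model

variable {k : ℕ} {μ : ℝ} {Θ : Type*} {M : Θ → Scenario k μ}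

theorem integral_le_upperMean {a b : ℝ} (T : Statistic k) (m : ℕ) {θ : Θ}
    (hθ : θ ∈ scenariosIn M a b) :
    ((∫ x, T m x ∂((M θ).law m) : ℝ) : EReal) ≤ upperMean M a b T m :=
  le_iSup₂ (f := fun θ (_ : θ ∈ scenariosIn M a b) =>
    ((∫ x, T m x ∂((M θ).law m) : ℝ) : EReal)) θ hθ

theorem upperMean_le {a b B : ℝ} {T : Statistic k} {m : ℕ}
    (h : ∀ θ ∈ scenariosIn M a b, ∫ x, T m x ∂((M θ).law m) ≤ B) :
    upperMean M a b T m ≤ B :=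
  iSup₂_le fun θ hθ => EReal.coe_le_coe_iff.2 (h θ hθ)

theorem tendsto_lowerMean_iff {a b c : ℝ} {T : Statistic k} :
    Tendsto (lowerMean M a b T) atTop (𝓝 (c : EReal)) ↔
      Tendsto (upperMean M a b fun m x => - T m x) atTop (𝓝 ((-c : ℝ) : EReal)) := by
  constructor <;> intro h
  · have := h.neg
    simpa [lowerMean] using this
  · have := h.neg
    rw [EReal.coe_neg, neg_neg] at this
    exact this

theorem eventually_integral_le_of_tendsto_upperMean {a b c ε : ℝ} {T : Statistic k}
    (h : Tendsto (upperMean M a b T) atTop (𝓝 (c : EReal))) (hε : 0 < ε) :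
    ∀ᶠ m in atTop, ∀ θ ∈ scenariosIn M a b, ∫ x, T m x ∂((M θ).law m) ≤ c + ε := by
  have hlt : (c : EReal) < ((c + ε : ℝ) : EReal) := EReal.coe_lt_coe_iff.2 (by linarith)
  filter_upwards [h.eventually_lt_const hlt] with m hm θ hθ
  exact EReal.coe_le_coe_iff.1 ((integral_le_upperMean T m hθ).trans hm.le)

theorem limsup_upperMean_nonpos {a b : ℝ} {T : Statistic k}
    (h : ∀ ε : ℝ, 0 < ε → ∀ᶠ m in atTop, ∀ θ ∈ scenariosIn M a b,
      ∫ x, T m x ∂((M θ).law m) ≤ ε) :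
    limsup (upperMean M a b T) atTop ≤ 0 := by
  refine le_of_forall_gt fun c hc => ?_
  obtain ⟨ε, hε, hεc⟩ := EReal.lt_iff_exists_real_btwn.1 hc
  have hε0 : 0 < ε := by exact_mod_cast hε
  refine lt_of_le_of_lt (limsup_le_of_le (by isBoundedDefault) ?_) hεc
  filter_upwards [h ε hε0] with m hm
  exact upperMean_le hm

/-- Uniform `L¹` convergence of the sub-sample variances under the sublinear expectation. -/
theorem UniformlySquareIntegrable.eventually_varError_le (hU : UniformlySquareIntegrable M)
    {a b ε : ℝ} (ha : 0 < a) (hab : a ≤ b) (hε : 0 < ε) :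
    ∀ᶠ m in atTop, ∀ θ ∈ scenariosIn M a b, (M θ).varError m ≤ ε := by
  have h := Scenario.eventually_varError_le (S := M '' scenariosIn M a b) (B := b)
    (by rintro _ ⟨θ, hθ, rfl⟩ i; exact (hθ i).2)
    (fun ε hε => by
      obtain ⟨c, hc⟩ := hU a b ha hab ε hε
      refine ⟨c, ?_⟩
      rintro _ ⟨θ, hθ, rfl⟩
      exact hc θ hθ) hε
  filter_upwards [h] with m hm θ hθ
  exact hm _ ⟨θ, hθ, rfl⟩

/-- The upper estimate needs the error to be small uniformly over the scenarios; the lower one only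
uses a scenario attaining `B`. -/
theorem tendsto_upperMean_comp_subVars (hU : UniformlySquareIntegrable M) {K : NNReal}
    {f : (Fin k → ℝ) → ℝ} (hf : LipschitzWith K f) {a b B : ℝ} (ha : 0 < a) (hab : a ≤ b)
    (hB : ∀ θ ∈ scenariosIn M a b, f (M θ).var ≤ B)
    (hattain : ∃ θ ∈ scenariosIn M a b, f (M θ).var = B) :
    Tendsto (upperMean M a b fun _ x => f (subVars x)) atTop (𝓝 (B : EReal)) := by
  -- `K + 1` replaces `K` as a divisor because `K` may be 0.
  have hK : (0 : ℝ) < K + 1 := by positivity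
  have key : ∀ ε : ℝ, 0 < ε → ∀ᶠ m in atTop, ∀ θ ∈ scenariosIn M a b,
      |∫ x, f (subVars x) ∂((M θ).law m) - f (M θ).var| ≤ ε := by
    intro ε hε
    filter_upwards [hU.eventually_varError_le ha hab (div_pos hε hK), eventually_ge_atTop 2]
      with m hm hm2 θ hθ
    refine ((M θ).abs_integral_comp_subVars_sub_le hm2 hf).trans ?_
    calc (K : ℝ) * (M θ).varError m ≤ K * (ε / (K + 1)) := by gcongr; exact hm θ hθ
      _ ≤ (K + 1) * (ε / (K + 1)) := by gcongr; linarith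
      _ = ε := by field_simp
  refine tendsto_order.2 ⟨fun c hc => ?_, fun c hc => ?_⟩
  · obtain ⟨r, hcr, hrB⟩ := EReal.lt_iff_exists_real_btwn.1 hc
    have hr : r < B := by exact_mod_cast hrB
    obtain ⟨θ, hθ, hθB⟩ := hattain
    filter_upwards [key (B - r) (by linarith)] with m hm
    refine hcr.trans_le (le_trans (EReal.coe_le_coe_iff.2 ?_) (integral_le_upperMean _ m hθ))
    have := (abs_le.1 (hm θ hθ)).1
    linarith
  · obtain ⟨r, hBr, hrc⟩ := EReal.lt_iff_exists_real_btwn.1 hc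
    have hr : B < r := by exact_mod_cast hBr
    filter_upwards [key (r - B) (by linarith)] with m hm
    refine (upperMean_le fun θ hθ => ?_).trans_lt hrc
    have h1 := (abs_le.1 (hm θ hθ)).2
    have h2 := hB θ hθ
    linarith

theorem le_of_tendsto_upperMean_comp_subVars {K : NNReal} {f : (Fin k → ℝ) → ℝ}
    (hf : LipschitzWith K f) {a b B : ℝ} {θ : Θ} (hθ : θ ∈ scenariosIn M a b)
    (hlim : Tendsto (upperMean M a b fun _ x => f (subVars x)) atTop (𝓝 (B : EReal))) :
    f (M θ).var ≤ B := by
  have h := (continuous_coe_real_ereal.tendsto _).comp ((M θ).tendsto_integral_comp_subVars hf)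
  exact EReal.coe_le_coe_iff.1 (le_of_tendsto_of_tendsto' h hlim fun m =>
    integral_le_upperMean (fun _ x => f (subVars x)) m hθ)

/-- Model variances are taken positive, but a sample variance can vanish. The shift `z + t` with `t
↓ 0` closes this gap. -/
theorem le_of_forall_pos_le {f g : (Fin k → ℝ) → ℝ} (hf : Continuous f) (hg : Continuous g)
    (h : ∀ v : Fin k → ℝ, (∀ i, 0 < v i) → f v ≤ g v) {z : Fin k → ℝ} (hz : ∀ i, 0 ≤ z i) :
    f z ≤ g z := by
  have hc : Continuous fun t : ℝ => fun i => z i + t := by fun_prop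
  have h0 : (fun i => z i + (0 : ℝ)) = z := by simp
  have hF := ((hf.comp hc).tendsto 0).mono_left (nhdsWithin_le_nhds (s := Set.Ioi 0))
  have hG := ((hg.comp hc).tendsto 0).mono_left (nhdsWithin_le_nhds (s := Set.Ioi 0))
  simp only [Function.comp_apply, h0] at hF hG
  refine le_of_tendsto_of_tendsto hF hG ?_
  filter_upwards [self_mem_nhdsWithin] with t ht
  exact h _ fun i => add_pos_of_nonneg_of_pos (hz i) ht

/-! ### Unbiasedness and extremality of the two estimators -/

variable [NeZero k]

theorem vecMax_var_mem {a b : ℝ} {θ : Θ} (hθ : θ ∈ scenariosIn M a b) :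
    vecMax (M θ).var ∈ Set.Icc a b := by
  obtain ⟨i, hi⟩ := exists_eq_vecMax (M θ).var
  exact hi ▸ hθ i

theorem vecMin_var_mem {a b : ℝ} {θ : Θ} (hθ : θ ∈ scenariosIn M a b) :
    vecMin (M θ).var ∈ Set.Icc a b := by
  obtain ⟨i, hi⟩ := exists_eq_vecMin (M θ).var
  exact hi ▸ hθ i

/-- With these tightest bounds, the limit demanded by unbiasedness is the extreme variance of the
scenario itself. -/
theorem mem_scenariosIn_vecMin_vecMax (θ : Θ) :
    θ ∈ scenariosIn M (vecMin (M θ).var) (vecMax (M θ).var) :=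
  fun i => ⟨vecMin_le _ i, le_vecMax _ i⟩

/-- Unbiasedness for all variance bounds bounds the mean under each scenario by the largest
variance of that scenario, uniformly. -/
theorem AsympUnbiasedUpper.eventually_integral_le {T : Statistic k}
    (hT : AsympUnbiasedUpper M T) {a b ε : ℝ} (ha : 0 < a) (hε : 0 < ε) :
    ∀ᶠ m in atTop, ∀ θ ∈ scenariosIn M a b,
      ∫ x, T m x ∂((M θ).law m) ≤ vecMax (M θ).var + 2 * ε := by
  -- Convergence is not assumed uniform in the upper bound, so only finitely many bounds with
  -- spacing `ε` are used.
  have hgrid : ∀ᶠ m in atTop, ∀ l ∈ Finset.range (⌈(b - a) / ε⌉₊ + 1),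
      ∀ θ ∈ scenariosIn M a (a + l * ε), ∫ x, T m x ∂((M θ).law m) ≤ a + l * ε + ε :=
    (eventually_all_finset _).2 fun l _ => eventually_integral_le_of_tendsto_upperMean
      (hT.2 a (a + l * ε) ha (by have : 0 ≤ l * ε := by positivity
                                 linarith)) hε
  filter_upwards [hgrid] with m hm θ hθ
  obtain ⟨hMa, hMb⟩ := vecMax_var_mem hθ
  set s := vecMax (M θ).var
  have h0 : 0 ≤ (s - a) / ε := div_nonneg (by linarith) hε.le
  have hle : s ≤ a + ⌈(s - a) / ε⌉₊ * ε := by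
    have := (div_le_iff₀ hε).1 (Nat.le_ceil ((s - a) / ε))
    linarith
  have hlt : a + ⌈(s - a) / ε⌉₊ * ε ≤ s + ε := by
    have h1 := mul_le_mul_of_nonneg_right (Nat.ceil_lt_add_one h0).le hε.le
    rw [add_mul, div_mul_cancel₀ _ hε.ne'] at h1
    linarith
  have hmem : ⌈(s - a) / ε⌉₊ ∈ Finset.range (⌈(b - a) / ε⌉₊ + 1) :=
    Finset.mem_range.2 (Nat.lt_succ_of_le (Nat.ceil_le_ceil (by gcongr)))
  -- Rounding `s` up to the grid costs one `ε`, the limit the other.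
  have := hm _ hmem θ fun i => ⟨(hθ i).1, (le_vecMax _ i).trans hle⟩
  linarith

/-- Unbiasedness for all variance bounds bounds the mean under each scenario from below by the
smallest variance of that scenario, uniformly. -/
theorem AsympUnbiasedLower.eventually_le_integral {T : Statistic k}
    (hT : AsympUnbiasedLower M T) {a b ε : ℝ} (ha : 0 < a) (hab : a ≤ b) (hε : 0 < ε) :
    ∀ᶠ m in atTop, ∀ θ ∈ scenariosIn M a b,
      vecMin (M θ).var - 2 * ε ≤ ∫ x, T m x ∂((M θ).law m) := by
  -- Lower bounds must stay positive, so the grid descending from `b` is cut off at `a`.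
  have hgrid : ∀ᶠ m in atTop, ∀ l ∈ Finset.range (⌈(b - a) / ε⌉₊ + 1),
      ∀ θ ∈ scenariosIn M (max a (b - l * ε)) b,
        ∫ x, - T m x ∂((M θ).law m) ≤ - max a (b - l * ε) + ε :=
    (eventually_all_finset _).2 fun l _ => eventually_integral_le_of_tendsto_upperMean
      (tendsto_lowerMean_iff.1 (hT.2 (max a (b - l * ε)) b (ha.trans_le (le_max_left _ _))
        (max_le hab (by have : 0 ≤ l * ε := by positivity
                        linarith)))) hε
  filter_upwards [hgrid] with m hm θ hθ
  obtain ⟨hMa, hMb⟩ := vecMin_var_mem hθ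
  set s := vecMin (M θ).var
  have h0 : 0 ≤ (b - s) / ε := div_nonneg (by linarith) hε.le
  have hle : b - ⌈(b - s) / ε⌉₊ * ε ≤ s := by
    have := (div_le_iff₀ hε).1 (Nat.le_ceil ((b - s) / ε))
    linarith
  have hlt : s - ε ≤ b - ⌈(b - s) / ε⌉₊ * ε := by
    have h1 := mul_le_mul_of_nonneg_right (Nat.ceil_lt_add_one h0).le hε.le
    rw [add_mul, div_mul_cancel₀ _ hε.ne'] at h1
    linarith
  have hmem : ⌈(b - s) / ε⌉₊ ∈ Finset.range (⌈(b - a) / ε⌉₊ + 1) :=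
    Finset.mem_range.2 (Nat.lt_succ_of_le (Nat.ceil_le_ceil (by gcongr)))
  have := hm _ hmem θ fun i => ⟨(max_le hMa hle).trans (vecMin_le _ i), (hθ i).2⟩
  rw [integral_neg] at this
  linarith [le_max_right a (b - ⌈(b - s) / ε⌉₊ * ε)]

theorem asympUnbiasedUpper_maxVar (hM : AllVariancesPossible M)
    (hU : UniformlySquareIntegrable M) : AsympUnbiasedUpper M (maxVar k) := by
  refine ⟨fun θ m hm => (M θ).integrable_maxVar hm,
    fun a b ha hab => ?_⟩
  obtain ⟨θ, hθ⟩ := hM (fun _ => b) fun _ => ha.trans_le hab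
  have hmem : θ ∈ scenariosIn M a b := fun i => by rw [hθ i]; exact ⟨hab, le_rfl⟩
  obtain ⟨i, hi⟩ := exists_eq_vecMax (M θ).var
  exact tendsto_upperMean_comp_subVars hU lipschitzWith_vecMax ha hab
    (fun θ hθ => (vecMax_var_mem hθ).2) ⟨θ, hmem, hi.trans (hθ i)⟩

theorem asympUnbiasedLower_minVar (hM : AllVariancesPossible M)
    (hU : UniformlySquareIntegrable M) : AsympUnbiasedLower M (minVar k) := by
  refine ⟨fun θ m hm => (M θ).integrable_minVar hm,
    fun a b ha hab => tendsto_lowerMean_iff.2 ?_⟩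
  obtain ⟨θ, hθ⟩ := hM (fun _ => a) fun _ => ha
  have hmem : θ ∈ scenariosIn M a b := fun i => by rw [hθ i]; exact ⟨le_rfl, hab⟩
  obtain ⟨i, hi⟩ := exists_eq_vecMin (M θ).var
  exact tendsto_upperMean_comp_subVars hU lipschitzWith_vecMin.neg ha hab
    (fun θ hθ => neg_le_neg (vecMin_var_mem hθ).1)
    ⟨θ, hmem, congrArg Neg.neg (hi.trans (hθ i))⟩

/-- Both means are compared with the largest variance of the scenario: that of `T` exceeds it by at
most `ε`, that of `maxVar` is never below it. -/
theorem AsympUnbiasedUpper.asympLE_maxVar {T : Statistic k} (hT : AsympUnbiasedUpper M T) :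
    AsympLE M T (maxVar k) := by
  refine fun a b ha _ => limsup_upperMean_nonpos fun ε hε => ?_
  filter_upwards [hT.eventually_integral_le (b := b) ha (half_pos hε), eventually_ge_atTop 2]
    with m hm hm2 θ hθ
  rw [integral_sub (hT.1 θ m hm2) ((M θ).integrable_maxVar hm2)]
  linarith [hm θ hθ, (M θ).vecMax_var_le_integral hm2]

theorem AsympUnbiasedLower.minVar_asympLE {T : Statistic k} (hT : AsympUnbiasedLower M T) :
    AsympLE M (minVar k) T := by
  refine fun a b ha hab => limsup_upperMean_nonpos fun ε hε => ?_
  filter_upwards [hT.eventually_le_integral ha hab (half_pos hε), eventually_ge_atTop 2]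
    with m hm hm2 θ hθ
  rw [integral_sub ((M θ).integrable_minVar hm2) (hT.1 θ m hm2)]
  linarith [hm θ hθ, (M θ).integral_le_vecMin_var hm2]

/-- The asymptotic hypothesis yields a bound for every `m ≥ 2` because `f` does not depend on `m`:
it forces `f ≤ vecMax` on all positive vectors. -/
theorem AsympUnbiasedUpper.comp_subVars_le (hM : AllVariancesPossible M) {K : NNReal}
    {f : (Fin k → ℝ) → ℝ} (hf : LipschitzWith K f)
    (hT : AsympUnbiasedUpper M fun _ x => f (subVars x)) {m : ℕ} (hm : 2 ≤ m)
    (x : Fin k → Fin m → ℝ) : f (subVars x) ≤ maxVar k m x := by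
  refine le_of_forall_pos_le (g := vecMax) hf.continuous lipschitzWith_vecMax.continuous
    (fun v hv => ?_) fun i => sampleVar_nonneg hm (x i)
  obtain ⟨θ, hθ⟩ := hM v hv
  obtain rfl : (M θ).var = v := funext hθ
  obtain ⟨i, hi⟩ := exists_eq_vecMin (M θ).var
  have hmem := mem_scenariosIn_vecMin_vecMax (M := M) θ
  exact le_of_tendsto_upperMean_comp_subVars hf hmem
    (hT.2 _ _ (hi ▸ hv i) (vecMax_var_mem hmem).1)

theorem AsympUnbiasedLower.le_comp_subVars (hM : AllVariancesPossible M) {K : NNReal}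
    {f : (Fin k → ℝ) → ℝ} (hf : LipschitzWith K f)
    (hT : AsympUnbiasedLower M fun _ x => f (subVars x)) {m : ℕ} (hm : 2 ≤ m)
    (x : Fin k → Fin m → ℝ) : minVar k m x ≤ f (subVars x) := by
  refine le_of_forall_pos_le (f := vecMin) lipschitzWith_vecMin.continuous hf.continuous
    (fun v hv => ?_) fun i => sampleVar_nonneg hm (x i)
  obtain ⟨θ, hθ⟩ := hM v hv
  obtain rfl : (M θ).var = v := funext hθ
  obtain ⟨i, hi⟩ := exists_eq_vecMin (M θ).var
  have hmem := mem_scenariosIn_vecMin_vecMax (M := M) θ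
  exact neg_le_neg_iff.1 (le_of_tendsto_upperMean_comp_subVars hf.neg hmem
    (tendsto_lowerMean_iff.1 (hT.2 _ _ (hi ▸ hv i) (vecMax_var_mem hmem).1)))

end Model

theorem theorem2 {k : ℕ} [NeZero k] {μ : ℝ} {Θ : Type*} (M : Θ → Scenario k μ)
    (hM : AllVariancesPossible M) :
    -- under each scenario, the estimators are asymptotically unbiased for `max σᵢ²`, `min σᵢ²`
    (∀ θ, Tendsto (fun m => ∫ x, maxVar k m x ∂((M θ).law m)) atTop (𝓝 (vecMax (M θ).var)) ∧
      Tendsto (fun m => ∫ x, minVar k m x ∂((M θ).law m)) atTop (𝓝 (vecMin (M θ).var))) ∧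
    -- they are asymptotically unbiased under the sublinear expectation
    (UniformlySquareIntegrable M →
      AsympUnbiasedUpper M (maxVar k) ∧ AsympUnbiasedLower M (minVar k)) ∧
    -- among all statistics, they are asymptotically the largest, respectively the smallest
    (∀ T : Statistic k, AsympUnbiasedUpper M T → AsympLE M T (maxVar k)) ∧
    (∀ T : Statistic k, AsympUnbiasedLower M T → AsympLE M (minVar k) T) ∧
    -- among Lipschitz functions of the sub-sample variances, they are so pointwise
    (∀ (K : NNReal) (f : (Fin k → ℝ) → ℝ), LipschitzWith K f →
      AsympUnbiasedUpper M (fun _ x => f (subVars x)) →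
      ∀ m, 2 ≤ m → ∀ x : Fin k → Fin m → ℝ, f (subVars x) ≤ maxVar k m x) ∧
    (∀ (K : NNReal) (f : (Fin k → ℝ) → ℝ), LipschitzWith K f →
      AsympUnbiasedLower M (fun _ x => f (subVars x)) →
      ∀ m, 2 ≤ m → ∀ x : Fin k → Fin m → ℝ, minVar k m x ≤ f (subVars x)) := by
  exact ⟨fun θ => ⟨(M θ).tendsto_integral_comp_subVars lipschitzWith_vecMax,
      (M θ).tendsto_integral_comp_subVars lipschitzWith_vecMin⟩,
    fun hU => ⟨asympUnbiasedUpper_maxVar hM hU, asympUnbiasedLower_minVar hM hU⟩,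
    fun _ hT => hT.asympLE_maxVar, fun _ hT => hT.minVar_asympLE,
    fun _ _ hf hT _ hm x => hT.comp_subVars_le hM hf hm x,
    fun _ _ hf hT _ hm x => hT.le_comp_subVars hM hf hm x⟩
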